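/- **Theorem 5.** Let $(\Omega,\mathcal F,P)$ be a probability space, let $1<\zeta\le 2$ and $\varphi(t)=|t|^\zeta/\zeta$. A random variable $\xi$ is $\varphi$-sub-Gaussian, $\xi\in\mathrm{Sub}_\varphi(\Omega)$, if for some $a\ge 0$ one has $E\exp\{\lambda\xi\}\le\exp\{\varphi(a\lambda)\}$ for all $\lambda\in\mathbb R$; $\tau_\varphi(\xi)$ denotes the infimum of all such $a$. Let $(B,\rho)$ be a compact metric space with at least two points, and let $N_B(u)$ be the minimal number of closed balls of radius $u$ that cover $B$. Let $X=\{X(t),t\in B\}$ be a separable stochastic process with $X(t)\in\mathrm{Sub}_\varphi(\Omega)$ for all $t$, and let $X(t)=\sum_{k=0}^\infty\xi_k a_k(t)$ be an expansion, convergent in mean square for every $t\in B$, with square integrable random variables $\xi_k$ and functions $a_k:B\to\mathbb R$. Let $X_N(t)=\sum_{k=0}^N\xi_k a_k(t)$ be the corresponding model, assume that $X_N(t)\in\mathrm{Sub}_\varphi(\Omega)$ for all $t$, and put $\Delta_N(t)=X(t)-X_N(t)$. Let $\sigma,\sigma_N$ be continuous strictly increasing functions on $(0,\infty)$ that tend to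 $0$ as $h\to 0$, such that for all $h>0$ $$\sup_{\rho(t,s)\le h}\tau_\varphi\big(X(t)-X(s)\big)\le\sigma(h),\qquad \sup_{\rho(t,s)\le h}\tau_\varphi\big(\Delta_N(t)-\Delta_N(s)\big)\le\sigma_N(h),$$ and put $\beta=\sigma\big(\inf_{s\in B}\sup_{t\in B}\rho(t,s)\big)$. Let $r:[1,\infty)\to\mathbb R$ be continuous and strictly increasing, with $r(u)>0$ for $u>1$, and such that $t\mapsto r(e^t)$ is convex on $(0,\infty)$. Let $p\in(0,1)$, suppose that $(0,\beta p]$ is contained in the range of $\sigma_N$, so that the inverse function $\sigma_N^{(-1)}$ is defined there, and that $\int_0^{\beta p}r\big(N_B(\sigma_N^{(-1)}(u))\big)\,du<\infty$. Let $\gamma_N^\zeta=\sup_{u\in B}\tau_\varphi^\zeta(\Delta_N(u))$, let $\delta>0$, and let $r^{(-1)}$ be the inverse function of $r$. If $$\nu\ \ge\ 2\exp\left\{-\frac{(\zeta-1)\,(\delta(1-p))^{\frac{\zeta}{\zeta-1}}}{\zeta\,\big(\gamma_N^\zeta(1-p)+p\beta^\zeta\big)^{\frac1{\zeta-1}}}\right\}\;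 r^{(-1)}\left(\frac1{\beta p}\int_0^{\beta p} r\big(N_B(\sigma_N^{(-1)}(u))\big)\,du\right),$$ then the model $X_N$ approximates the process $X$ with reliability $1-\nu$ and accuracy $\delta$ in $C(B)$, that is, $$P\Big\{\sup_{t\in B}|X(t)-X_N(t)|>\delta\Big\}\le\nu .$$ -/

import Mathlib

open MeasureTheory Filter Topology Set

namespace SubPhi

variable {Ω B : Type*} [MeasurableSpace Ω]

/-- The even power function `φ(t) = |t|^ζ / ζ`. -/
noncomputable def powerPhi (ζ t : ℝ) : ℝ := |t| ^ ζ / ζ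

/-- `a ≥ 0` and `E exp(c ξ) ≤ exp(φ(a c))` for all real `c`, the expectations being finite. -/
def IsBound (φ : ℝ → ℝ) (μ : Measure Ω) (ξ : Ω → ℝ) (a : ℝ) : Prop :=
  0 ≤ a ∧ ∀ c : ℝ, Integrable (fun ω => Real.exp (c * ξ ω)) μ ∧
    ∫ ω, Real.exp (c * ξ ω) ∂μ ≤ Real.exp (φ (a * c))

/-- `ξ` is a `φ`-sub-Gaussian random variable. -/
def IsSubGaussian (φ : ℝ → ℝ) (μ : Measure Ω) (ξ : Ω → ℝ) : Prop :=
  ∃ a : ℝ, IsBound φ μ ξ a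

/-- The `φ`-sub-Gaussian standard `τ_φ(ξ)`. -/
noncomputable def tau (φ : ℝ → ℝ) (μ : Measure Ω) (ξ : Ω → ℝ) : ℝ :=
  sInf {a : ℝ | IsBound φ μ ξ a}

/-- `X` is a `φ`-sub-Gaussian process: every `X t` is `φ`-sub-Gaussian. -/
def IsSubGaussianProcess (φ : ℝ → ℝ) (μ : Measure Ω) (X : B → Ω → ℝ) : Prop :=
  ∀ t, IsSubGaussian φ μ (X t)

/-- Doob separability of a real process: there is a countable dense `S` such that almost surely
the graph of the sample path lies in the closure of its restriction to `S`. -/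
def IsSeparableProcess [TopologicalSpace B] (μ : Measure Ω) (X : B → Ω → ℝ) : Prop :=
  ∃ S : Set B, S.Countable ∧ Dense S ∧
    ∀ᵐ ω ∂μ, ∀ t, (t, X t ω) ∈ closure ((fun s => (s, X s ω)) '' S)

/-- `σ` is a continuous increasing function on `(0, ∞)` that tends to `0` at `0` and satisfies
`sup_{ρ(t,s) ≤ h} τ_φ(X t - X s) ≤ σ h` for all `h > 0`. -/
structure IsModulus [PseudoMetricSpace B] (φ : ℝ → ℝ) (μ : Measure Ω) (X : B → Ω → ℝ)
    (σ : ℝ → ℝ) : Prop where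
  continuousOn : ContinuousOn σ (Ioi 0)
  strictMonoOn : StrictMonoOn σ (Ioi 0)
  tendsto_zero : Tendsto σ (𝓝[>] 0) (𝓝 0)
  bound : ∀ h, 0 < h → ∀ t s, dist t s ≤ h → tau φ μ (fun ω => X t ω - X s ω) ≤ σ h

/-- `inf_s sup_t ρ(t, s)`. -/
noncomputable def radius (B : Type*) [PseudoMetricSpace B] : ℝ := ⨅ s : B, ⨆ t : B, dist t s

/-- Metric massiveness: the minimal number of closed balls of radius `u` that cover `B`. -/
noncomputable def massiveness (B : Type*) [PseudoMetricSpace B] (u : ℝ) : ℕ :=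
  (Metric.coveringNumber u.toNNReal (univ : Set B)).toNat

/-- The inverse function of `σ : (0, ∞) → ℝ`, used on the range of `σ`. -/
noncomputable def modulusInv (σ : ℝ → ℝ) : ℝ → ℝ := Function.invFunOn σ (Ioi 0)

/-- The inverse function of `r : [1, ∞) → ℝ`, used on the range of `r`. -/
noncomputable def entropyInv (r : ℝ → ℝ) : ℝ → ℝ := Function.invFunOn r (Ici 1)

/-- `r` is a continuous increasing function on `[1, ∞)`, positive on `(1, ∞)`, such that
`t ↦ r (exp t)` is convex on `(0, ∞)`. -/
structure IsEntropyFunction (r : ℝ → ℝ) : Prop where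
  continuousOn : ContinuousOn r (Ici 1)
  strictMonoOn : StrictMonoOn r (Ici 1)
  pos : ∀ u, 1 < u → 0 < r u
  convexOn : ConvexOn ℝ (Ioi 0) (fun t => r (Real.exp t))

/-- `XN` is the model of `X`: for a mean square convergent expansion
`X t = ∑_{k ≥ 0} ξ_k a_k(t)` it is the partial sum `XN t = ∑_{k = 0}^N ξ_k a_k(t)`. -/
def IsModel (μ : Measure Ω) (X : B → Ω → ℝ) (N : ℕ) (XN : B → Ω → ℝ) : Prop :=
  ∃ (ξ : ℕ → Ω → ℝ) (a : ℕ → B → ℝ),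
    (∀ k, MemLp (ξ k) 2 μ) ∧
    (∀ t, Tendsto (fun n : ℕ =>
      eLpNorm (fun ω => X t ω - ∑ k ∈ Finset.range n, ξ k ω * a k t) 2 μ) atTop (𝓝 0)) ∧
    ∀ t ω, XN t ω = ∑ k ∈ Finset.range (N + 1), ξ k ω * a k t

/-- `XN` approximates `X` with reliability `1 - ν` and accuracy `δ` in the uniform norm:
`P{sup_t |X t - XN t| > δ} ≤ ν`. -/
def Approximates (μ : Measure Ω) (X XN : B → Ω → ℝ) (ν δ : ℝ) : Prop :=
  μ {ω | ENNReal.ofReal δ < ⨆ t, ENNReal.ofReal |X t ω - XN t ω|} ≤ ENNReal.ofReal ν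

end SubPhi

/-! The proof chains the error process `Y = X - XN`. Cover `B` by minimal nets `V k` of radius
`σN⁻¹(β p^(k+1))` and move each point of `V (k+1)` to a nearby point of `V k`. A value of `Y` on a
fine net is then a value on `V 0`, of standard at most `γ`, plus telescoping increments of standard
at most `β p^k` at level `k ≥ 1`.

Hölder's inequality with weights `w k`, equal to `(1 - p) p^k` except at the last level, splits the
exponential moment of the maximum into levels (`lintegral_chainMajorant_le`). The weights decay like
the standards, so for exponent `(1 - p) s` the levels together contribute at most `exp (s^ζ A / ζ)`
with `A = γ^ζ (1 - p) + p β^ζ` (`sum_geomWeight_mul_powerPhi_le`). The net sizes contribute `2 exp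
(∑ w k log N k)`. Jensen's inequality for `r ∘ exp` and a lower Riemann sum bound this by the
entropy integral (`exp_sum_geomWeight_mul_log_massiveness_le`). Fatou's lemma refines the nets, and
Markov's inequality with the optimal `s` (`exists_optimal_exponent`) gives the tail on countable
sets.

The full supremum needs `Y` separable. The model lives in a finite-dimensional space of random
variables and is mean square continuous, hence almost surely continuous (`IsModel.ae_continuous`),
so `Y` inherits separability from `X`. -/

namespace SubPhi

/-! ### Calculus of the `φ`-sub-Gaussian standard. -/

section SubGaussian

variable {Ω B : Type*} [MeasurableSpace Ω] {μ : Measure Ω} {ζ : ℝ}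

lemma powerPhi_mul_le (hζ : 0 < ζ) {a b : ℝ} (ha : 0 ≤ a) (hab : a ≤ b) (c : ℝ) :
    powerPhi ζ (a * c) ≤ powerPhi ζ (b * c) := by
  unfold powerPhi
  rw [abs_mul, abs_mul, abs_of_nonneg ha, abs_of_nonneg (ha.trans hab)]
  gcongr

lemma continuous_powerPhi (hζ : 0 < ζ) : Continuous (powerPhi ζ) := by
  unfold powerPhi
  exact (continuous_abs.rpow_const fun _ => Or.inr hζ.le).div_const _

lemma IsBound.mono (hζ : 0 < ζ) {ξ : Ω → ℝ} {a b : ℝ} (h : IsBound (powerPhi ζ) μ ξ a)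
    (hab : a ≤ b) : IsBound (powerPhi ζ) μ ξ b :=
  ⟨h.1.trans hab, fun c => ⟨(h.2 c).1, (h.2 c).2.trans
    (Real.exp_le_exp.2 (powerPhi_mul_le hζ h.1 hab c))⟩⟩

lemma tau_nonneg (φ : ℝ → ℝ) (ξ : Ω → ℝ) : 0 ≤ tau φ μ ξ :=
  Real.sInf_nonneg fun _ h => h.1

/-- The infimum defining `τ_φ` is attained. -/
lemma IsSubGaussian.isBound_tau (hζ : 0 < ζ) {ξ : Ω → ℝ} (h : IsSubGaussian (powerPhi ζ) μ ξ) :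
    IsBound (powerPhi ζ) μ ξ (tau (powerPhi ζ) μ ξ) := by
  refine ⟨tau_nonneg _ _, fun c => ⟨?_, ?_⟩⟩
  · obtain ⟨a, ha⟩ := h
    exact (ha.2 c).1
  · have hc : Tendsto (fun a => Real.exp (powerPhi ζ (a * c)))
        (𝓝[>] (tau (powerPhi ζ) μ ξ)) (𝓝 (Real.exp (powerPhi ζ (tau (powerPhi ζ) μ ξ * c)))) := by
      refine Tendsto.mono_left ?_ nhdsWithin_le_nhds
      exact (Real.continuous_exp.comp ((continuous_powerPhi hζ).comp
        (continuous_id.mul continuous_const))).tendsto _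
    refine ge_of_tendsto hc ?_
    filter_upwards [self_mem_nhdsWithin] with a ha
    obtain ⟨b, hb, hba⟩ := exists_lt_of_csInf_lt h ha
    exact ((IsBound.mono hζ hb hba.le).2 c).2

lemma IsSubGaussian.isBound_of_tau_le (hζ : 0 < ζ) {ξ : Ω → ℝ} {a : ℝ}
    (h : IsSubGaussian (powerPhi ζ) μ ξ) (ha : tau (powerPhi ζ) μ ξ ≤ a) :
    IsBound (powerPhi ζ) μ ξ a :=
  (h.isBound_tau hζ).mono hζ ha

lemma IsBound.tau_le {ξ : Ω → ℝ} {a : ℝ} {φ : ℝ → ℝ} (h : IsBound φ μ ξ a) : tau φ μ ξ ≤ a :=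
  csInf_le ⟨0, fun _ h => h.1⟩ h

lemma IsBound.neg {ξ : Ω → ℝ} {a : ℝ} (h : IsBound (powerPhi ζ) μ ξ a) :
    IsBound (powerPhi ζ) μ (fun ω => -ξ ω) a := by
  refine ⟨h.1, fun c => ?_⟩
  have := h.2 (-c)
  simpa [powerPhi] using this

lemma exp_mul_add_le (c x y : ℝ) :
    Real.exp (c * (x + y)) ≤ (Real.exp (2 * c * x) + Real.exp (2 * c * y)) / 2 := by
  have h1 : Real.exp (2 * c * x) = Real.exp (c * x) ^ 2 := by
    rw [← Real.exp_nat_mul]; congr 1; push_cast; ring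
  have h2 : Real.exp (2 * c * y) = Real.exp (c * y) ^ 2 := by
    rw [← Real.exp_nat_mul]; congr 1; push_cast; ring
  rw [h1, h2, mul_add, Real.exp_add]
  nlinarith [sq_nonneg (Real.exp (c * x) - Real.exp (c * y))]

/-- Measurability is not part of `IsBound`; it is recovered as the logarithm of the integrable `exp
ξ`. -/
lemma IsBound.aemeasurable {ξ : Ω → ℝ} {a : ℝ} {φ : ℝ → ℝ} (h : IsBound φ μ ξ a) :
    AEMeasurable ξ μ := by
  have := ((h.2 1).1.aestronglyMeasurable.aemeasurable).log
  simpa using this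

/-- The arithmetic-geometric mean inequality decouples the two exponentials. The constant is crude,
but it serves only for finiteness and convergence to zero. -/
lemma IsBound.add (hζ : 0 < ζ) {ξ η : Ω → ℝ} {a b : ℝ} (h : IsBound (powerPhi ζ) μ ξ a)
    (h' : IsBound (powerPhi ζ) μ η b) :
    IsBound (powerPhi ζ) μ (fun ω => ξ ω + η ω) (2 * max a b) := by
  have hm : 0 ≤ max a b := h.1.trans (le_max_left _ _)
  refine ⟨by positivity, fun c => ?_⟩
  have h1 := (h.mono hζ (le_max_left a b)).2 (2 * c)
  have h2 := (h'.mono hζ (le_max_right a b)).2 (2 * c)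
  have hi : Integrable (fun ω => (Real.exp (2 * c * ξ ω) + Real.exp (2 * c * η ω)) / 2) μ :=
    (h1.1.add h2.1).div_const 2
  have hm : AEStronglyMeasurable (fun ω => Real.exp (c * (ξ ω + η ω))) μ :=
    (Real.measurable_exp.comp_aemeasurable
      ((h.aemeasurable.add h'.aemeasurable).const_mul c)).aestronglyMeasurable
  have hint : Integrable (fun ω => Real.exp (c * (ξ ω + η ω))) μ := by
    refine hi.mono' hm (ae_of_all _ fun ω => ?_)
    rw [Real.norm_eq_abs, abs_of_pos (Real.exp_pos _)]
    exact exp_mul_add_le _ _ _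
  refine ⟨hint, (integral_mono hint hi fun ω => exp_mul_add_le _ _ _).trans ?_⟩
  have e : (2 * max a b) * c = max a b * (2 * c) := by ring
  rw [integral_div, integral_add h1.1 h2.1, e]
  linarith [h1.2, h2.2]

lemma IsBound.sub (hζ : 0 < ζ) {ξ η : Ω → ℝ} {a b : ℝ} (h : IsBound (powerPhi ζ) μ ξ a)
    (h' : IsBound (powerPhi ζ) μ η b) :
    IsBound (powerPhi ζ) μ (fun ω => ξ ω - η ω) (2 * max a b) := by
  simpa [sub_eq_add_neg] using h.add hζ h'.neg

lemma IsSubGaussian.sub (hζ : 0 < ζ) {ξ η : Ω → ℝ} (h : IsSubGaussian (powerPhi ζ) μ ξ)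
    (h' : IsSubGaussian (powerPhi ζ) μ η) :
    IsSubGaussian (powerPhi ζ) μ (fun ω => ξ ω - η ω) := by
  obtain ⟨a, ha⟩ := h
  obtain ⟨b, hb⟩ := h'
  exact ⟨_, ha.sub hζ hb⟩

lemma sq_le_exp_add_exp (x : ℝ) : x ^ 2 ≤ 2 * (Real.exp x + Real.exp (-x)) := by
  have h1 := Real.exp_pos x
  have h2 := Real.exp_pos (-x)
  rcases le_total 0 x with h | h
  · have := Real.quadratic_le_exp_of_nonneg h
    nlinarith
  · have := Real.quadratic_le_exp_of_nonneg (neg_nonneg.2 h)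
    nlinarith

lemma lintegral_ofReal_exp_le {ξ : Ω → ℝ} {a : ℝ} {φ : ℝ → ℝ} (h : IsBound φ μ ξ a) (c : ℝ) :
    ∫⁻ ω, ENNReal.ofReal (Real.exp (c * ξ ω)) ∂μ ≤ ENNReal.ofReal (Real.exp (φ (a * c))) := by
  rw [← ofReal_integral_eq_lintegral_ofReal (h.2 c).1 (ae_of_all _ fun _ => (Real.exp_pos _).le)]
  exact ENNReal.ofReal_le_ofReal (h.2 c).2

/-- The second moment is controlled by the `φ`-sub-Gaussian standard. -/
lemma IsBound.lintegral_sq_le {ξ : Ω → ℝ} {a : ℝ} (h : IsBound (powerPhi ζ) μ ξ a)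
    (ha : 0 < a) :
    ∫⁻ ω, ENNReal.ofReal (ξ ω ^ 2) ∂μ ≤ ENNReal.ofReal (4 * Real.exp (1 / ζ) * a ^ 2) := by
  -- The choice `c = ±a⁻¹` normalizes `|a c| = 1`, where `φ` equals `1 / ζ`.
  have key : ∀ c : ℝ, |c| = a⁻¹ → ∫⁻ ω, ENNReal.ofReal (Real.exp (c * ξ ω)) ∂μ
      ≤ ENNReal.ofReal (Real.exp (1 / ζ)) := by
    intro c hc
    refine (lintegral_ofReal_exp_le h c).trans_eq ?_
    have : |a * c| = 1 := by rw [abs_mul, hc, abs_of_pos ha, mul_inv_cancel₀ ha.ne']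
    simp [powerPhi, this]
  have hp : ∀ ω, ENNReal.ofReal (ξ ω ^ 2) ≤ ENNReal.ofReal (2 * a ^ 2) *
      (ENNReal.ofReal (Real.exp (a⁻¹ * ξ ω)) + ENNReal.ofReal (Real.exp (-a⁻¹ * ξ ω))) := by
    intro ω
    rw [← ENNReal.ofReal_add (Real.exp_pos _).le (Real.exp_pos _).le,
      ← ENNReal.ofReal_mul (by positivity)]
    refine ENNReal.ofReal_le_ofReal ?_
    have h1 := sq_le_exp_add_exp (a⁻¹ * ξ ω)
    have h2 : ξ ω ^ 2 = a ^ 2 * (a⁻¹ * ξ ω) ^ 2 := by field_simp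
    rw [h2, neg_mul]
    nlinarith [sq_nonneg a]
  have hmeas : AEMeasurable (fun ω => ENNReal.ofReal (Real.exp (a⁻¹ * ξ ω))) μ :=
    (h.2 _).1.aestronglyMeasurable.aemeasurable.ennreal_ofReal
  calc _ ≤ _ := lintegral_mono hp
    _ = ENNReal.ofReal (2 * a ^ 2) * (∫⁻ ω, ENNReal.ofReal (Real.exp (a⁻¹ * ξ ω)) ∂μ
        + ∫⁻ ω, ENNReal.ofReal (Real.exp (-a⁻¹ * ξ ω)) ∂μ) := by
      rw [lintegral_const_mul' _ _ ENNReal.ofReal_ne_top, lintegral_add_left' hmeas]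
    _ ≤ ENNReal.ofReal (2 * a ^ 2) * (ENNReal.ofReal (Real.exp (1 / ζ)) +
        ENNReal.ofReal (Real.exp (1 / ζ))) := by
      gcongr
      · exact key _ (abs_of_pos (by positivity))
      · exact key _ (by rw [abs_neg]; exact abs_of_pos (by positivity))
    _ = _ := by
      rw [← ENNReal.ofReal_add (Real.exp_pos _).le (Real.exp_pos _).le,
        ← ENNReal.ofReal_mul (by positivity)]
      congr 1; ring

end SubGaussian

/-! ### Continuity of the model and separability of the error. -/

section PathContinuity

variable {Ω B : Type*} [MeasurableSpace Ω] {μ : Measure Ω} {ζ : ℝ}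

lemma IsBound.eLpNorm_le {ξ : Ω → ℝ} {a : ℝ} (h : IsBound (powerPhi ζ) μ ξ a)
    (ha : 0 < a) : eLpNorm ξ 2 μ ≤ ENNReal.ofReal (√(4 * Real.exp (1 / ζ)) * a) := by
  have h1 : ∫⁻ ω, ‖ξ ω‖ₑ ^ (2 : ℝ) ∂μ = ∫⁻ ω, ENNReal.ofReal (ξ ω ^ 2) ∂μ := by
    refine lintegral_congr fun ω => ?_
    rw [← sq_abs, ENNReal.ofReal_pow (abs_nonneg _), Real.enorm_eq_ofReal_abs]
    norm_cast
  rw [eLpNorm_eq_lintegral_rpow_enorm_toReal (by norm_num) (by norm_num)]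
  simp only [ENNReal.toReal_ofNat]
  rw [h1]
  calc _ ≤ ENNReal.ofReal (4 * Real.exp (1 / ζ) * a ^ 2) ^ (1 / 2 : ℝ) := by
        gcongr
        exact h.lintegral_sq_le ha
    _ = _ := by
        rw [ENNReal.ofReal_rpow_of_nonneg (by positivity) (by norm_num), ← Real.sqrt_eq_rpow,
          Real.sqrt_mul (by positivity), Real.sqrt_sq ha.le]

/-- A process with values in a finite-dimensional space of random variables which is continuous
in mean square has almost surely continuous paths. -/
lemma ae_continuous_of_tendsto_eLpNorm [TopologicalSpace B] {n : ℕ} {ξ : Fin n → Ω → ℝ}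
    (hξ : ∀ k, MemLp (ξ k) 2 μ) (a : B → Fin n → ℝ)
    (h : ∀ t, Tendsto (fun s => eLpNorm (fun ω => ∑ k, ξ k ω * a s k - ∑ k, ξ k ω * a t k) 2 μ)
      (𝓝 t) (𝓝 0)) :
    ∀ᵐ ω ∂μ, Continuous fun t => ∑ k, ξ k ω * a t k := by
  let u : (Fin n → ℝ) →ₗ[ℝ] Lp ℝ 2 μ := Fintype.linearCombination ℝ fun k => (hξ k).toLp
  have hu : ∀ x, u x =ᵐ[μ] fun ω => ∑ k, ξ k ω * x k := by
    intro x
    have e : u x = MemLp.toLp (fun ω => ∑ k, ξ k ω * x k)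
        (memLp_finsetSum _ fun k _ => (hξ k).mul_const (x k)) := by
      rw [Fintype.linearCombination_apply]
      apply Lp.ext
      refine (Lp.coeFn_finsetSum _ _).trans (EventuallyEq.trans ?_ (MemLp.coeFn_toLp _).symm)
      have : ∀ᵐ ω ∂μ, ∀ k, (x k • (hξ k).toLp : Lp ℝ 2 μ) ω = ξ k ω * x k := by
        rw [ae_all_iff]
        intro k
        filter_upwards [Lp.coeFn_smul (x k) (hξ k).toLp, (hξ k).coeFn_toLp] with ω h1 h2
        rw [h1, Pi.smul_apply, h2, smul_eq_mul, mul_comm]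
      filter_upwards [this] with ω hω
      simp [hω]
    rw [e]
    exact MemLp.coeFn_toLp _
  have huc : Continuous fun t => u (a t) := by
    refine continuous_iff_continuousAt.2 fun t => ?_
    rw [ContinuousAt, tendsto_iff_norm_sub_tendsto_zero]
    have h0 := (ENNReal.tendsto_toReal ENNReal.zero_ne_top).comp (h t)
    refine h0.congr fun s => ?_
    rw [Lp.norm_def, Function.comp]
    congr 1
    refine eLpNorm_congr_ae ?_
    filter_upwards [Lp.coeFn_sub (u (a s)) (u (a t)), hu (a s), hu (a t)] with ω h1 h2 h3
    rw [h1, Pi.sub_apply, h2, h3]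
  -- The coefficients `a t` may be discontinuous along the kernel of `u`. A linear section on the
  -- finite-dimensional range is continuous and yields continuous coefficients `b t` for the same
  -- random variable.
  obtain ⟨g, hg⟩ := u.rangeRestrict.exists_rightInverse_of_surjective u.range_rangeRestrict
  have hgc : Continuous g := g.continuous_of_finiteDimensional
  let b : B → Fin n → ℝ := fun t => g (u.rangeRestrict (a t))
  have hb : Continuous b := hgc.comp (huc.subtype_mk _)
  have hker : ∀ t, a t - b t ∈ LinearMap.ker u := by
    intro t
    have : u.rangeRestrict (b t) = u.rangeRestrict (a t) := LinearMap.congr_fun hg _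
    have := congrArg Subtype.val this
    simpa [LinearMap.mem_ker, sub_eq_zero] using this.symm
  -- A finite basis of the kernel makes the exceptional null set independent of `t`.
  let e := Module.finBasis ℝ (LinearMap.ker u)
  have hae : ∀ᵐ ω ∂μ, ∀ i, ∑ k, ξ k ω * (e i : Fin n → ℝ) k = 0 := by
    rw [ae_all_iff]
    intro i
    have h1 := hu (e i)
    rw [LinearMap.mem_ker.1 (e i).2] at h1
    filter_upwards [h1, Lp.coeFn_zero ℝ 2 μ] with ω h1 h2
    rw [← h1, h2]; rfl
  filter_upwards [hae] with ω hω
  have hzero : ∀ x ∈ LinearMap.ker u, ∑ k, ξ k ω * x k = 0 := by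
    intro x hx
    let l : (Fin n → ℝ) →ₗ[ℝ] ℝ := Fintype.linearCombination ℝ fun k => ξ k ω
    have hl : ∀ y, l y = ∑ k, ξ k ω * y k := fun y => by
      simp [l, Fintype.linearCombination_apply, mul_comm]
    have : l.comp (LinearMap.ker u).subtype = 0 := e.ext fun i => by simpa [hl] using hω i
    simpa [hl] using LinearMap.congr_fun this ⟨x, hx⟩
  have : (fun t => ∑ k, ξ k ω * a t k) = fun t => ∑ k, ξ k ω * b t k := by
    funext t
    have := hzero _ (hker t)
    simp only [Pi.sub_apply, mul_sub, Finset.sum_sub_distrib] at this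
    linarith
  rw [this]
  exact continuous_finsetSum _ fun k _ => continuous_const.mul ((continuous_apply k).comp hb)

lemma IsModulus.pos [PseudoMetricSpace B] {φ : ℝ → ℝ} {X : B → Ω → ℝ} {σ : ℝ → ℝ}
    (hσ : IsModulus φ μ X σ) {h : ℝ} (hh : 0 < h) : 0 < σ h := by
  have h2 : 0 < h / 2 := by positivity
  refine lt_of_le_of_lt ?_ (hσ.strictMonoOn h2 hh (half_lt_self hh))
  refine le_of_tendsto hσ.tendsto_zero ?_
  filter_upwards [Ioo_mem_nhdsGT h2] with x hx
  exact (hσ.strictMonoOn hx.1 h2 hx.2).le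

/-- A model of a process is almost surely continuous as soon as the process and the error of the
model have moduli of continuity with respect to `τ_φ`. -/
lemma IsModel.ae_continuous [PseudoMetricSpace B] (hζ : 0 < ζ) {X XN : B → Ω → ℝ} {N : ℕ}
    (hX : IsSubGaussianProcess (powerPhi ζ) μ X) (hXN : IsSubGaussianProcess (powerPhi ζ) μ XN)
    (hmodel : IsModel μ X N XN) {σ σN : ℝ → ℝ} (hσ : IsModulus (powerPhi ζ) μ X σ)
    (hσN : IsModulus (powerPhi ζ) μ (fun t ω => X t ω - XN t ω) σN) :
    ∀ᵐ ω ∂μ, Continuous fun t => XN t ω := by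
  obtain ⟨ξ, a, hξ, -, hsum⟩ := hmodel
  have hsum' : ∀ t ω, XN t ω = ∑ k : Fin (N + 1), ξ k ω * a k t := by
    intro t ω
    rw [hsum, Finset.sum_range fun k => ξ k ω * a k t]
  have hbound : ∀ h, 0 < h → ∀ t s, dist t s ≤ h →
      IsBound (powerPhi ζ) μ (fun ω => XN t ω - XN s ω) (2 * max (σ h) (σN h)) := by
    intro h hh t s hts
    have h1 := ((hX t).sub hζ (hX s)).isBound_of_tau_le hζ (hσ.bound h hh t s hts)
    have h2 := (((hX t).sub hζ (hXN t)).sub hζ ((hX s).sub hζ (hXN s))).isBound_of_tau_le hζ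
      (hσN.bound h hh t s hts)
    -- An increment of `XN` is the increment of `X` minus that of the error.
    convert h1.sub hζ h2 using 2
    ring
  have hlim : Tendsto (fun h => ENNReal.ofReal
      (√(4 * Real.exp (1 / ζ)) * (2 * max (σ h) (σN h)))) (𝓝[>] 0) (𝓝 0) := by
    have := (((hσ.tendsto_zero.max hσN.tendsto_zero).const_mul 2).const_mul
      (√(4 * Real.exp (1 / ζ))))
    simpa using ENNReal.tendsto_ofReal this
  simp only [hsum'] at hbound ⊢
  refine ae_continuous_of_tendsto_eLpNorm (fun k => hξ k) (fun t k => a k t) fun t => ?_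
  rw [ENNReal.tendsto_nhds_zero]
  intro ε hε
  obtain ⟨h, hh, hh0⟩ := ((ENNReal.tendsto_nhds_zero.1 hlim ε hε).and
    self_mem_nhdsWithin).exists
  filter_upwards [Metric.closedBall_mem_nhds t hh0] with s hs
  refine le_trans ?_ hh
  refine (hbound h hh0 s t hs).eLpNorm_le ?_
  have := hσ.pos hh0
  positivity

/-- Subtracting an almost surely continuous process preserves separability. -/
lemma IsSeparableProcess.sub [TopologicalSpace B] {X Y : B → Ω → ℝ}
    (hX : IsSeparableProcess μ X) (hY : ∀ᵐ ω ∂μ, Continuous fun t => Y t ω) :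
    IsSeparableProcess μ fun t ω => X t ω - Y t ω := by
  obtain ⟨S, hS, hd, h⟩ := hX
  refine ⟨S, hS, hd, ?_⟩
  filter_upwards [h, hY] with ω h hY t
  -- This continuous shear carries the graph of `X` to the graph of `X - Y`.
  let F : B × ℝ → B × ℝ := fun q => (q.1, q.2 - Y q.1 ω)
  have hF : Continuous F :=
    continuous_fst.prodMk (continuous_snd.sub (hY.comp continuous_fst))
  have := image_closure_subset_closure_image hF ⟨_, h t, rfl⟩
  rwa [image_image] at this

end PathContinuity

/-! ### Nets, entropy functions and geometric weights. -/

section Entropy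

variable {B : Type*}

lemma coveringNumber_univ_ne_top [PseudoMetricSpace B] [CompactSpace B] {u : ℝ} (hu : 0 < u) :
    Metric.coveringNumber u.toNNReal (univ : Set B) ≠ ⊤ := by
  obtain ⟨C, -, hC, hcov⟩ := isCompact_univ.finite_cover_balls (X := B) hu
  have h : Metric.IsCover u.toNNReal (univ : Set B) C := by
    rw [Metric.isCover_iff_subset_iUnion_closedBall, Real.coe_toNNReal _ hu.le]
    exact hcov.trans (iUnion₂_mono fun _ _ => Metric.ball_subset_closedBall)
  exact ne_top_of_le_ne_top hC.encard_lt_top.ne (h.coveringNumber_le_encard (subset_univ _))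

/-- A minimal net. -/
lemma exists_net_card_eq_massiveness [PseudoMetricSpace B] [CompactSpace B] {u : ℝ}
    (hu : 0 < u) :
    ∃ V : Finset B, V.card = massiveness B u ∧ ∀ t, ∃ v ∈ V, dist t v ≤ u := by
  have h := coveringNumber_univ_ne_top (B := B) hu
  obtain ⟨C, -, hC, hcov, hcard⟩ := Metric.exists_set_encard_eq_coveringNumber h
  refine ⟨hC.toFinset, ?_, fun t => ?_⟩
  · rw [massiveness, ← hcard, hC.encard_eq_coe_toFinset_card, ENat.toNat_natCast]
  · rw [Metric.isCover_iff_subset_iUnion_closedBall, Real.coe_toNNReal _ hu.le] at hcov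
    simpa using hcov (mem_univ t)

lemma massiveness_anti [PseudoMetricSpace B] [CompactSpace B] {u v : ℝ} (hu : 0 < u)
    (huv : u ≤ v) : massiveness B v ≤ massiveness B u :=
  ENat.toNat_le_toNat (Metric.coveringNumber_anti (Real.toNNReal_le_toNNReal huv))
    (coveringNumber_univ_ne_top hu)

lemma one_le_massiveness [PseudoMetricSpace B] [CompactSpace B] [Nonempty B] {u : ℝ}
    (hu : 0 < u) : 1 ≤ massiveness B u := by
  obtain ⟨V, hV, h⟩ := exists_net_card_eq_massiveness (B := B) hu
  obtain ⟨v, hv, -⟩ := h (Classical.arbitrary B)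
  rw [← hV]
  exact Finset.card_pos.2 ⟨v, hv⟩

lemma radius_pos [MetricSpace B] [CompactSpace B] [Nontrivial B] : 0 < radius B := by
  obtain ⟨x, y, hxy⟩ := exists_pair_ne B
  have hd : 0 < dist x y := dist_pos.2 hxy
  refine (half_pos hd).trans_le (le_ciInf fun s => ?_)
  have hb : BddAbove (range fun t => dist t s) :=
    (isCompact_range (continuous_id.dist continuous_const)).bddAbove
  have h1 := le_ciSup hb x
  have h2 := le_ciSup hb y
  have := dist_triangle_right x y s
  linarith

section EntropyFunction

variable {r : ℝ → ℝ}

/-- Convexity extends to the endpoint by shifting and continuity. The endpoint matters because a net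
with one point has logarithm `0`. -/
lemma IsEntropyFunction.convexOn_Ici (hr : IsEntropyFunction r) :
    ConvexOn ℝ (Ici 0) fun t => r (Real.exp t) := by
  have hc : ContinuousOn (fun t => r (Real.exp t)) (Ici 0) :=
    hr.continuousOn.comp Real.continuous_exp.continuousOn fun t ht => Real.one_le_exp ht
  refine ⟨convex_Ici 0, fun x hx y hy a b ha hb hab => ?_⟩
  have hx' : (0 : ℝ) ≤ x := hx
  have hy' : (0 : ℝ) ≤ y := hy
  have lim : ∀ z : ℝ, 0 ≤ z → Tendsto (fun ε : ℝ => r (Real.exp (z + ε))) (𝓝[>] 0)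
      (𝓝 (r (Real.exp z))) := by
    intro z hz
    have h1 : Tendsto (fun ε : ℝ => z + ε) (𝓝[>] 0) (𝓝[Ici 0] z) := by
      refine tendsto_nhdsWithin_iff.2 ⟨?_, ?_⟩
      · have : Tendsto (fun ε : ℝ => z + ε) (𝓝 0) (𝓝 (z + 0)) :=
          (continuous_const.add continuous_id).tendsto _
        rw [add_zero] at this
        exact this.mono_left nhdsWithin_le_nhds
      · filter_upwards [self_mem_nhdsWithin] with ε hε
        exact add_nonneg hz (le_of_lt hε)
    exact (hc z hz).tendsto.comp h1
  have hz : 0 ≤ a • x + b • y := by simp only [smul_eq_mul]; positivity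
  refine le_of_tendsto_of_tendsto (lim _ hz) (((lim x hx').const_smul a).add
    ((lim y hy').const_smul b)) ?_
  filter_upwards [self_mem_nhdsWithin] with ε hε
  have hε' : (0 : ℝ) < ε := hε
  have := hr.convexOn.2 (x := x + ε) (y := y + ε) (mem_Ioi.2 (by positivity))
    (mem_Ioi.2 (by positivity)) ha hb hab
  have e : a • x + b • y + ε = a • (x + ε) + b • (y + ε) := by
    simp only [smul_eq_mul]
    linear_combination (-ε) * hab
  simpa only [e] using this

/-- An entropy function is unbounded, so its range is `[r 1, ∞)`. -/
lemma IsEntropyFunction.mem_image (hr : IsEntropyFunction r) {y : ℝ} (hy : r 1 ≤ y) :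
    y ∈ r '' Ici 1 := by
  set f : ℝ → ℝ := fun t => r (Real.exp t) with hf
  have hconv : ConvexOn ℝ (Ici 0) f := hr.convexOn_Ici
  have hd : 0 < f 1 - f 0 := by
    have := hr.strictMonoOn (a := 1) (b := Real.exp 1) self_mem_Ici
      (Real.one_le_exp zero_le_one) (by simp)
    simpa [hf] using this
  obtain ⟨T, hT1, hT⟩ : ∃ T, 1 ≤ T ∧ y ≤ f T := by
    -- Beyond `1` the chord slopes of `f` from `1` are at least `f 1 - f 0`, so this distance gains
    -- at least `|y - f 1|`.
    refine ⟨1 + |y - f 1| / (f 1 - f 0), by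
      have : 0 ≤ |y - f 1| / (f 1 - f 0) := by positivity
      linarith, ?_⟩
    rcases eq_or_lt_of_le (abs_nonneg (y - f 1)) with h0 | h0
    · rw [← h0, zero_div, add_zero]
      linarith [abs_eq_zero.1 h0.symm]
    · set T := 1 + |y - f 1| / (f 1 - f 0)
      have hT : 1 < T := by
        have : 0 < |y - f 1| / (f 1 - f 0) := by positivity
        simp only [T]; linarith
      have := hconv.slope_mono_adjacent (x := 0) (y := 1) (z := T) self_mem_Ici
        (mem_Ici.2 (by linarith)) one_pos hT
      rw [sub_zero, div_one, le_div_iff₀ (by linarith)] at this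
      have e : (f 1 - f 0) * (T - 1) = |y - f 1| := by simp only [T]; field_simp; ring
      rw [e] at this
      linarith [le_abs_self (y - f 1)]
  have hiv := intermediate_value_Icc (a := 1) (b := Real.exp T) (f := r)
    (Real.one_le_exp (by linarith)) (hr.continuousOn.mono Icc_subset_Ici_self)
  obtain ⟨x, hx, hxy⟩ := hiv ⟨hy, hT⟩
  exact ⟨x, hx.1, hxy⟩

lemma IsEntropyFunction.le_entropyInv (hr : IsEntropyFunction r) {x y : ℝ} (hx : 1 ≤ x)
    (hxy : r x ≤ y) : x ≤ entropyInv r y := by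
  have hy : y ∈ r '' Ici 1 :=
    hr.mem_image ((hr.strictMonoOn.monotoneOn self_mem_Ici hx hx).trans hxy)
  have h1 : r (entropyInv r y) = y := Function.invFunOn_eq hy
  have h2 : entropyInv r y ∈ Ici 1 := Function.invFunOn_mem hy
  rw [← h1] at hxy
  exact (hr.strictMonoOn.le_iff_le hx h2).1 hxy

/-- Jensen's inequality for an entropy function. -/
lemma IsEntropyFunction.map_exp_sum_log_le (hr : IsEntropyFunction r) {ι : Type*} {s : Finset ι}
    {w n : ι → ℝ} (hw : ∀ i ∈ s, 0 ≤ w i) (hw1 : ∑ i ∈ s, w i = 1) (hn : ∀ i ∈ s, 1 ≤ n i) :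
    r (Real.exp (∑ i ∈ s, w i * Real.log (n i))) ≤ ∑ i ∈ s, w i * r (n i) := by
  have := hr.convexOn_Ici.map_sum_le (t := s) (w := w) (p := fun i => Real.log (n i)) hw hw1
    fun i hi => Real.log_nonneg (hn i hi)
  simp only [smul_eq_mul] at this
  refine this.trans_eq (Finset.sum_congr rfl fun i hi => ?_)
  rw [Real.exp_log (by linarith [hn i hi])]

end EntropyFunction

/-- The geometric weights `(1 - p) p^k` for `k < m`, completed by `p^m` at `k = m`. -/
noncomputable def geomWeight (p : ℝ) (m k : ℕ) : ℝ := if k < m then (1 - p) * p ^ k else p ^ k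

lemma geomWeight_pos {p : ℝ} (hp₀ : 0 < p) (hp₁ : p < 1) (m k : ℕ) : 0 < geomWeight p m k := by
  have : 0 < 1 - p := sub_pos.2 hp₁
  unfold geomWeight; split_ifs <;> positivity

lemma le_geomWeight {p : ℝ} (hp₀ : 0 < p) (m k : ℕ) :
    (1 - p) * p ^ k ≤ geomWeight p m k := by
  have : 0 < p ^ k := by positivity
  unfold geomWeight; split_ifs
  · exact le_rfl
  · nlinarith

lemma sum_geomWeight_mul (p : ℝ) (m : ℕ) (f : ℕ → ℝ) :
    ∑ k ∈ Finset.range (m + 1), geomWeight p m k * f k =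
      ∑ k ∈ Finset.range m, (1 - p) * p ^ k * f k + p ^ m * f m := by
  rw [Finset.sum_range_succ]
  congr 1
  · refine Finset.sum_congr rfl fun k hk => ?_
    rw [geomWeight, if_pos (Finset.mem_range.1 hk)]
  · simp [geomWeight]

lemma sum_geomWeight (p : ℝ) (m : ℕ) :
    ∑ k ∈ Finset.range (m + 1), geomWeight p m k = 1 := by
  have := sum_geomWeight_mul p m fun _ => 1
  simp only [mul_one] at this
  rw [this, ← Finset.mul_sum]
  linear_combination mul_neg_geom_sum p m

/-- A geometric lower sum of the integral of an antitone function. -/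
lemma sum_geomWeight_mul_le_integral {p b : ℝ} (hp₀ : 0 < p) (hp₁ : p < 1) (hb : 0 < b)
    {f : ℝ → ℝ} (hf : AntitoneOn f (Ioc 0 b)) (hint : IntegrableOn f (Ioc 0 b)) (m : ℕ) :
    b * ∑ k ∈ Finset.range (m + 1), geomWeight p m k * f (b * p ^ k) ≤
      ∫ u in (0 : ℝ)..b, f u := by
  have hle : ∀ k, b * p ^ k ≤ b := fun k =>
    mul_le_of_le_one_right hb.le (pow_le_one₀ hp₀.le hp₁.le)
  have hpos : ∀ k, 0 < b * p ^ k := fun k => by positivity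
  have hII : ∀ {x y}, 0 ≤ x → x ≤ y → y ≤ b → IntervalIntegrable f volume x y := by
    intro x y hx hxy hy
    rw [intervalIntegrable_iff_integrableOn_Ioc_of_le hxy]
    exact hint.mono_set (Ioc_subset_Ioc hx hy)
  have hlow : ∀ {x y}, 0 ≤ x → x ≤ y → y ≤ b → 0 < y → (y - x) * f y ≤ ∫ u in x..y, f u := by
    intro x y hx hxy hy hy0
    have := intervalIntegral.integral_mono_on_of_le_Ioo hxy
      (intervalIntegrable_const (c := f y)) (hII hx hxy hy) fun u hu =>
        hf ⟨hx.trans_lt hu.1, hu.2.le.trans hy⟩ ⟨hy0, hy⟩ hu.2.le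
    simpa using this
  -- The interval from `b p^(k+1)` to `b p^k` has length `b (1 - p) p^k`, and `f` is smallest at its
  -- right end. The leftover interval from `0` to `b p^m` accounts for the last weight `p^m`.
  have hsum : ∀ m : ℕ, b * ∑ k ∈ Finset.range m, (1 - p) * p ^ k * f (b * p ^ k) ≤
      ∫ u in (b * p ^ m)..b, f u := by
    intro m
    induction m with
    | zero => simp
    | succ m ih =>
      have hstep : b * p ^ (m + 1) ≤ b * p ^ m :=
        mul_le_mul_of_nonneg_left (pow_le_pow_of_le_one hp₀.le hp₁.le m.le_succ) hb.le
      rw [← intervalIntegral.integral_add_adjacent_intervals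
        (hII (hpos (m + 1)).le hstep (hle m)) (hII (hpos m).le (hle m) le_rfl),
        Finset.sum_range_succ, mul_add, add_comm]
      refine add_le_add (le_trans (le_of_eq ?_)
        (hlow (hpos (m + 1)).le hstep (hle m) (hpos m))) ih
      ring
  rw [sum_geomWeight_mul, ← intervalIntegral.integral_add_adjacent_intervals
    (hII le_rfl (hpos m).le (hle m)) (hII (hpos m).le (hle m) le_rfl), mul_add, add_comm]
  refine add_le_add (le_trans (le_of_eq ?_) (hlow le_rfl (hpos m).le (hle m) (hpos m))) (hsum m)
  ring

end Entropy

/-! ### Chaining and the exponential moment of the maximum. -/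

section Chaining

variable {Ω B : Type*}

/-- The sum over the points `v ∈ V` of `exp (c D v) + exp (-c D v)`, a majorant of
`exp (c max_v |D v|)`. -/
noncomputable def expSum (V : Finset B) (D : B → Ω → ℝ) (c : ℝ) (ω : Ω) : ENNReal :=
  ∑ v ∈ V, (ENNReal.ofReal (Real.exp (c * D v ω)) + ENNReal.ofReal (Real.exp (-c * D v ω)))

lemma ofReal_exp_mul_le_expSum {V : Finset B} (D : B → Ω → ℝ) {c s : ℝ} {v : B}
    (hs : s = 1 ∨ s = -1) (hv : v ∈ V) (ω : Ω) :
    ENNReal.ofReal (Real.exp (c * (s * D v ω))) ≤ expSum V D c ω := by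
  refine le_trans ?_ (Finset.single_le_sum (f := fun v => ENNReal.ofReal (Real.exp (c * D v ω)) +
    ENNReal.ofReal (Real.exp (-c * D v ω))) (fun _ _ => zero_le) hv)
  rcases hs with rfl | rfl
  · simp
  · simp

/-- The weighted product of the majorants over the levels of a chain. -/
noncomputable def chainMajorant (V : ℕ → Finset B) (D : ℕ → B → Ω → ℝ) (w : ℕ → ℝ) (l : ℝ)
    (n : ℕ) (ω : Ω) : ENNReal :=
  ∏ k ∈ Finset.range n, expSum (V k) (D k) (l / w k) ω ^ w k

/-- One sign serves the whole sum, so the exponential factors over levels. Each factor is a `w k`-th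
power whose base is a summand of `expSum`. -/
lemma ofReal_exp_abs_sum_le_chainMajorant {V : ℕ → Finset B}
    {D : ℕ → B → Ω → ℝ} {w : ℕ → ℝ} {n : ℕ} (hw : ∀ k, 0 < w k) {l : ℝ} {v : ℕ → B}
    (hv : ∀ k ∈ Finset.range n, v k ∈ V k) (ω : Ω) :
    ENNReal.ofReal (Real.exp (l * |∑ k ∈ Finset.range n, D k (v k) ω|)) ≤
      chainMajorant V D w l n ω := by
  obtain ⟨s, hs, hsum⟩ : ∃ s : ℝ, (s = 1 ∨ s = -1) ∧
      |∑ k ∈ Finset.range n, D k (v k) ω| = s * ∑ k ∈ Finset.range n, D k (v k) ω := by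
    rcases abs_choice (∑ k ∈ Finset.range n, D k (v k) ω) with h | h
    · exact ⟨1, Or.inl rfl, by rw [h, one_mul]⟩
    · exact ⟨-1, Or.inr rfl, by rw [h, neg_one_mul]⟩
  rw [hsum, Finset.mul_sum, Finset.mul_sum, Real.exp_sum,
    ENNReal.ofReal_prod_of_nonneg fun k _ => (Real.exp_pos _).le]
  refine Finset.prod_le_prod' fun k hk => ?_
  refine le_trans (le_of_eq ?_) (ENNReal.rpow_le_rpow
    (ofReal_exp_mul_le_expSum (D k) (c := l / w k) hs (hv k hk) ω) (hw k).le)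
  rw [ENNReal.ofReal_rpow_of_nonneg (Real.exp_pos _).le (hw k).le, ← Real.exp_mul]
  congr 2
  have := (hw k).ne'
  field_simp

/-- The increments of a process along a chain of projections `π`. -/
def chainIncrement (Y : B → Ω → ℝ) (π : ℕ → B → B) : ℕ → B → Ω → ℝ
  | 0, v, ω => Y v ω
  | k + 1, v, ω => Y v ω - Y (π k v) ω

/-- The chain is built downwards from `v` by successive projections, and the increments telescope.
-/
lemma exists_chain (Y : B → Ω → ℝ) {V : ℕ → Finset B} {π : ℕ → B → B}
    (hπ : ∀ k t, π k t ∈ V k) (m : ℕ) {v : B} (hv : v ∈ V m) :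
    ∃ u : ℕ → B, (∀ k ∈ Finset.range (m + 1), u k ∈ V k) ∧
      ∀ ω, Y v ω = ∑ k ∈ Finset.range (m + 1), chainIncrement Y π k (u k) ω := by
  induction m generalizing v with
  | zero => exact ⟨fun _ => v, by simpa using hv, by simp [chainIncrement]⟩
  | succ m ih =>
    obtain ⟨u, hu, hsum⟩ := ih (hπ m v)
    have hne : ∀ k ∈ Finset.range (m + 1), k ≠ m + 1 := fun k hk =>
      (Finset.mem_range.1 hk).ne
    refine ⟨Function.update u (m + 1) v, fun k hk => ?_, fun ω => ?_⟩
    · rcases Finset.mem_range_succ_iff.1 hk |>.eq_or_lt with rfl | hk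
      · simpa using hv
      · rw [Function.update_of_ne hk.ne]
        exact hu k (Finset.mem_range.2 hk)
    · rw [Finset.sum_range_succ, Function.update_self]
      have : ∑ k ∈ Finset.range (m + 1), chainIncrement Y π k (Function.update u (m + 1) v k) ω =
          Y (π m v) ω := by
        rw [hsum]
        exact Finset.sum_congr rfl fun k hk => by rw [Function.update_of_ne (hne k hk)]
      rw [this, chainIncrement]
      ring

variable [MeasurableSpace Ω] {μ : Measure Ω} {ζ : ℝ}

lemma aemeasurable_expSum {φ : ℝ → ℝ} {V : Finset B} {D : B → Ω → ℝ} {b : ℝ}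
    (hD : ∀ v, IsBound φ μ (D v) b) (c : ℝ) : AEMeasurable (expSum V D c) μ := by
  have h : ∀ c v, AEMeasurable (fun ω => ENNReal.ofReal (Real.exp (c * D v ω))) μ := fun c v =>
    ((hD v).2 c).1.aestronglyMeasurable.aemeasurable.ennreal_ofReal
  exact Finset.aemeasurable_fun_sum _ fun v _ => (h c v).add (h (-c) v)

lemma lintegral_expSum_le {V : Finset B} {D : B → Ω → ℝ} {b : ℝ}
    (hD : ∀ v, IsBound (powerPhi ζ) μ (D v) b) (c : ℝ) :
    ∫⁻ ω, expSum V D c ω ∂μ ≤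
      ENNReal.ofReal (V.card * (2 * Real.exp (powerPhi ζ (b * c)))) := by
  have h : ∀ c v, AEMeasurable (fun ω => ENNReal.ofReal (Real.exp (c * D v ω))) μ := fun c v =>
    ((hD v).2 c).1.aestronglyMeasurable.aemeasurable.ennreal_ofReal
  unfold expSum
  rw [lintegral_finsetSum' V fun v _ => by exact (h c v).add (h (-c) v)]
  refine (Finset.sum_le_card_nsmul V _
    (ENNReal.ofReal (2 * Real.exp (powerPhi ζ (b * c)))) fun v _ => ?_).trans_eq ?_
  · rw [lintegral_add_left' (h c v), two_mul, ENNReal.ofReal_add (Real.exp_pos _).le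
      (Real.exp_pos _).le]
    refine add_le_add (lintegral_ofReal_exp_le (hD v) c)
      ((lintegral_ofReal_exp_le (hD v) (-c)).trans_eq ?_)
    simp [powerPhi]
  · rw [nsmul_eq_mul, ENNReal.ofReal_mul (Nat.cast_nonneg _), ENNReal.ofReal_natCast]

section ChainMajorant

variable {V : ℕ → Finset B} {D : ℕ → B → Ω → ℝ} {w b : ℕ → ℝ} {n : ℕ}

lemma aemeasurable_chainMajorant {φ : ℝ → ℝ} (hD : ∀ k v, IsBound φ μ (D k v) (b k)) (l : ℝ) :
    AEMeasurable (chainMajorant V D w l n) μ :=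
  Finset.aemeasurable_fun_prod _ fun k _ => (aemeasurable_expSum (hD k) _).pow_const _

/-- Hölder's inequality with exponents `1 / w k`. Since the weights sum to `1`, the factors `2` from
the two signs combine to a single `2`. -/
lemma lintegral_chainMajorant_le (hD : ∀ k v, IsBound (powerPhi ζ) μ (D k v) (b k))
    (hV : ∀ k, (V k).Nonempty) (hw : ∀ k, 0 < w k)
    (hw1 : ∑ k ∈ Finset.range n, w k = 1) (l : ℝ) :
    ∫⁻ ω, chainMajorant V D w l n ω ∂μ ≤ ENNReal.ofReal (2 *
      Real.exp (∑ k ∈ Finset.range n, w k * Real.log (V k).card) *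
      Real.exp (∑ k ∈ Finset.range n, w k * powerPhi ζ (b k * (l / w k)))) := by
  refine (ENNReal.lintegral_prod_norm_pow_le _ (fun k _ => aemeasurable_expSum (hD k) _) hw1
    fun k _ => (hw k).le).trans ?_
  have hterm : ∀ k, (∫⁻ ω, expSum (V k) (D k) (l / w k) ω ∂μ) ^ w k ≤
      ENNReal.ofReal (Real.exp (w k * Real.log 2 + w k * Real.log (V k).card +
        w k * powerPhi ζ (b k * (l / w k)))) := by
    intro k
    have hc : (0 : ℝ) < (V k).card := Nat.cast_pos.2 (hV k).card_pos
    refine (ENNReal.rpow_le_rpow (lintegral_expSum_le (hD k) _) (hw k).le).trans_eq ?_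
    rw [ENNReal.ofReal_rpow_of_nonneg (by positivity) (hw k).le]
    congr 1
    rw [Real.rpow_def_of_pos (by positivity), Real.log_mul hc.ne' (by positivity),
      Real.log_mul two_ne_zero (Real.exp_pos _).ne', Real.log_exp]
    congr 1; ring
  refine (Finset.prod_le_prod' fun k _ => hterm k).trans_eq ?_
  rw [← ENNReal.ofReal_prod_of_nonneg fun k _ => (Real.exp_pos _).le, ← Real.exp_sum,
    Finset.sum_add_distrib, Finset.sum_add_distrib, ← Finset.sum_mul, hw1, one_mul, Real.exp_add,
    Real.exp_add, Real.exp_log two_pos]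

end ChainMajorant

/-- Almost sure convergence to zero from square summable bounds. -/
lemma ae_tendsto_zero_of_isBound {ξ : ℕ → Ω → ℝ} {b : ℕ → ℝ}
    (h : ∀ k, IsBound (powerPhi ζ) μ (ξ k) (b k)) (hb : ∀ k, 0 < b k)
    (hsum : Summable fun k => b k ^ 2) : ∀ᵐ ω ∂μ, Tendsto (fun k => ξ k ω) atTop (𝓝 0) := by
  have hm : ∀ k, AEMeasurable (fun ω => ENNReal.ofReal (ξ k ω ^ 2)) μ := fun k =>
    ((h k).aemeasurable.pow_const 2).ennreal_ofReal
  have hfin : ∫⁻ ω, ∑' k, ENNReal.ofReal (ξ k ω ^ 2) ∂μ ≠ ⊤ := by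
    rw [lintegral_tsum hm]
    refine ne_top_of_le_ne_top ?_ (ENNReal.tsum_le_tsum fun k => (h k).lintegral_sq_le (hb k))
    exact (hsum.mul_left _).tsum_ofReal_ne_top
  filter_upwards [ae_lt_top' (AEMeasurable.tsum hm) hfin] with ω hω
  have h1 := ENNReal.tendsto_atTop_zero_of_tsum_ne_top hω.ne
  have h2 := (ENNReal.tendsto_toReal ENNReal.zero_ne_top).comp h1
  have h3 : Tendsto (fun k => √(ξ k ω ^ 2)) atTop (𝓝 0) := by
    have := h2.sqrt
    simpa [Function.comp_def, ENNReal.toReal_ofReal (sq_nonneg _)] using this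
  simp only [Real.sqrt_sq_eq_abs] at h3
  exact (tendsto_zero_iff_abs_tendsto_zero _).2 h3

/-- Exponential bound for the supremum over a countable set, by chaining. -/
theorem measure_exists_lt_abs_le_of_chain {Y : B → Ω → ℝ} {V : ℕ → Finset B} {π : ℕ → B → B}
    {b : ℕ → ℝ} {w : ℕ → ℕ → ℝ} {l C : ℝ} (hV : ∀ k, (V k).Nonempty)
    (hπ : ∀ k t, π k t ∈ V k)
    (hY : ∀ k t, IsBound (powerPhi ζ) μ (chainIncrement Y π k t) (b k))
    (hb : ∀ k, 0 < b (k + 1)) (hbs : Summable fun k => b (k + 1) ^ 2)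
    (hw : ∀ m k, 0 < w m k) (hw1 : ∀ m, ∑ k ∈ Finset.range (m + 1), w m k = 1) (hl : 0 < l)
    (hC : ∀ᶠ m in atTop, 2 *
      Real.exp (∑ k ∈ Finset.range (m + 1), w m k * Real.log (V k).card) *
      Real.exp (∑ k ∈ Finset.range (m + 1), w m k * powerPhi ζ (b k * (l / w m k))) ≤ C)
    {S : Set B} (hS : S.Countable) (δ : ℝ) :
    μ {ω | ∃ t ∈ S, δ < |Y t ω|} ≤ ENNReal.ofReal (Real.exp (-(l * δ)) * C) := by
  set D := chainIncrement Y π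
  let G : ℕ → Ω → ENNReal := fun m => chainMajorant V D (w m) l (m + 1)
  have hGm : ∀ m, AEMeasurable (G m) μ := fun m => aemeasurable_chainMajorant hY l
  -- Fatou's lemma is used because the majorants of different depths need not be monotone in `m`.
  have hG : ∫⁻ ω, liminf (fun m => G m ω) atTop ∂μ ≤ ENNReal.ofReal C := by
    refine (lintegral_liminf_le' hGm).trans ?_
    refine (liminf_le_liminf (v := fun _ : ℕ => ENNReal.ofReal C) ?_).trans_eq (liminf_const _)
    filter_upwards [hC] with m hm
    exact (lintegral_chainMajorant_le hY hV (hw m) (hw1 m) l).trans (ENNReal.ofReal_le_ofReal hm)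
  have hconv : ∀ᵐ ω ∂μ, ∀ t ∈ S, Tendsto (fun m => Y (π m t) ω) atTop (𝓝 (Y t ω)) := by
    rw [ae_ball_iff hS]
    intro t _
    filter_upwards [ae_tendsto_zero_of_isBound (fun k => hY (k + 1) t) hb hbs] with ω hω
    have := hω.const_sub (Y t ω)
    simpa [D, chainIncrement] using this
  have hle : ∀ᵐ ω ∂μ, ω ∈ {ω | ∃ t ∈ S, δ < |Y t ω|} →
      ω ∈ {ω | ENNReal.ofReal (Real.exp (l * δ)) ≤ liminf (fun m => G m ω) atTop} := by
    filter_upwards [hconv] with ω hω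
    rintro ⟨t, ht, hδ⟩
    have h1 : Tendsto (fun m => ENNReal.ofReal (Real.exp (l * |Y (π m t) ω|))) atTop
        (𝓝 (ENNReal.ofReal (Real.exp (l * |Y t ω|)))) :=
      ENNReal.tendsto_ofReal ((Real.continuous_exp.tendsto _).comp ((hω t ht).abs.const_mul l))
    calc ENNReal.ofReal (Real.exp (l * δ)) ≤ ENNReal.ofReal (Real.exp (l * |Y t ω|)) := by
          gcongr
      _ = liminf (fun m => ENNReal.ofReal (Real.exp (l * |Y (π m t) ω|))) atTop :=
          h1.liminf_eq.symm
      _ ≤ _ := by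
          refine liminf_le_liminf (Eventually.of_forall fun m => ?_)
          obtain ⟨u, hu, hsum⟩ := exists_chain Y hπ m (hπ m t)
          simp only [hsum]
          exact ofReal_exp_abs_sum_le_chainMajorant (hw m) hu ω
  refine (measure_mono_ae hle).trans ?_
  have hliminf : AEMeasurable (fun ω => liminf (fun m => G m ω) atTop) μ := by
    simp only [liminf_eq_iSup_iInf_of_nat]
    exact AEMeasurable.iSup fun n => AEMeasurable.iInf fun i => AEMeasurable.iInf fun _ => hGm i
  have hmarkov := (meas_ge_le_lintegral_div hliminf
    (ε := ENNReal.ofReal (Real.exp (l * δ))) (by simpa using Real.exp_pos _)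
    ENNReal.ofReal_ne_top).trans (ENNReal.div_le_div_right hG _)
  refine hmarkov.trans_eq ?_
  rw [← ENNReal.ofReal_div_of_pos (Real.exp_pos _), Real.exp_neg, div_eq_inv_mul]

end Chaining

/-! ### Optimal exponent and the sum over levels. -/

lemma powerPhi_of_nonneg {ζ t : ℝ} (ht : 0 ≤ t) : powerPhi ζ t = t ^ ζ / ζ := by
  rw [powerPhi, abs_of_nonneg ht]

/-- The Young–Fenchel transform of `t ↦ A t^ζ / ζ` at `D`, with the maximizing point. -/
lemma exists_optimal_exponent {ζ A D : ℝ} (hζ : 1 < ζ) (hA : 0 < A) (hD : 0 < D) :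
    ∃ s : ℝ, 0 < s ∧ -(s * D) + s ^ ζ * A / ζ =
      -((ζ - 1) * D ^ (ζ / (ζ - 1)) / (ζ * A ^ (1 / (ζ - 1)))) := by
  have hζ1 : 0 < ζ - 1 := sub_pos.2 hζ
  have hDA : 0 < D / A := div_pos hD hA
  -- This `s` solves the critical equation `s^(ζ-1) A = D`.
  refine ⟨(D / A) ^ (1 / (ζ - 1)), Real.rpow_pos_of_pos hDA _, ?_⟩
  have e1 : ((D / A) ^ (1 / (ζ - 1))) ^ ζ = (D / A) ^ (1 / (ζ - 1)) * (D / A) := by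
    rw [← Real.rpow_mul hDA.le]
    nth_rewrite 3 [← Real.rpow_one (D / A)]
    rw [← Real.rpow_add hDA]
    congr 1; field_simp; ring
  have e2 : D ^ (ζ / (ζ - 1)) = D ^ (1 / (ζ - 1)) * D := by
    nth_rewrite 3 [← Real.rpow_one D]
    rw [← Real.rpow_add hD]
    congr 1; field_simp; ring
  have hA' : 0 < A ^ (1 / (ζ - 1)) := Real.rpow_pos_of_pos hA _
  rw [e1, e2, Real.div_rpow hD.le hA.le]
  field_simp
  ring

/-- The factor `p^k` in the standard cancels against the weight, so every level `k ≥ 1` has argument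
at most `β s`, and these levels have total weight `p`. Positivity of `m` makes the weight at `0`
equal to `1 - p` instead of `1`. -/
lemma sum_geomWeight_mul_powerPhi_le {ζ p s β : ℝ} {b : ℕ → ℝ} (hζ : 0 < ζ) (hp₀ : 0 < p)
    (hp₁ : p < 1) (hb : ∀ k, b (k + 1) = β * p ^ (k + 1)) {m : ℕ}
    (hm : 0 < m) :
    ∑ k ∈ Finset.range (m + 1), geomWeight p m k *
        powerPhi ζ (b k * ((1 - p) * s / geomWeight p m k)) ≤
      (1 - p) * powerPhi ζ (b 0 * s) + p * powerPhi ζ (β * s) := by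
  have hp : 0 < 1 - p := sub_pos.2 hp₁
  have hw0 : geomWeight p m 0 = 1 - p := by simp [geomWeight, hm]
  have hsum : ∑ k ∈ Finset.range m, geomWeight p m (k + 1) = p := by
    have := sum_geomWeight p m
    rw [Finset.sum_range_succ', hw0] at this
    linarith
  rw [Finset.sum_range_succ', hw0, add_comm]
  refine add_le_add (le_of_eq ?_) ?_
  · rw [mul_div_cancel_left₀ _ hp.ne']
  · conv_rhs => rw [← hsum, Finset.sum_mul]
    refine Finset.sum_le_sum fun k _ => ?_
    have hw := geomWeight_pos hp₀ hp₁ m (k + 1)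
    refine mul_le_mul_of_nonneg_left ?_ hw.le
    have hle : (1 - p) * p ^ (k + 1) / geomWeight p m (k + 1) ≤ 1 :=
      (div_le_one hw).2 (le_geomWeight hp₀ m (k + 1))
    have h0 : 0 ≤ (1 - p) * p ^ (k + 1) / geomWeight p m (k + 1) := by positivity
    have e : b (k + 1) * ((1 - p) * s / geomWeight p m (k + 1)) =
        ((1 - p) * p ^ (k + 1) / geomWeight p m (k + 1)) * (β * s) := by
      rw [hb]; ring
    rw [e]
    simpa using powerPhi_mul_le hζ h0 hle (β * s)

/-! ### The entropy integral. -/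

section ModulusInv

variable {σ : ℝ → ℝ} {c : ℝ}

lemma modulusInv_pos (hrange : Ioc 0 c ⊆ σ '' Ioi 0) {u : ℝ} (hu : u ∈ Ioc 0 c) :
    0 < modulusInv σ u :=
  Function.invFunOn_mem (hrange hu)

lemma apply_modulusInv (hrange : Ioc 0 c ⊆ σ '' Ioi 0) {u : ℝ} (hu : u ∈ Ioc 0 c) :
    σ (modulusInv σ u) = u :=
  Function.invFunOn_eq (hrange hu)

lemma monotoneOn_modulusInv (hσ : StrictMonoOn σ (Ioi 0)) (hrange : Ioc 0 c ⊆ σ '' Ioi 0) :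
    MonotoneOn (modulusInv σ) (Ioc 0 c) := by
  intro u hu v hv huv
  rwa [← hσ.le_iff_le (modulusInv_pos hrange hu) (modulusInv_pos hrange hv),
    apply_modulusInv hrange hu, apply_modulusInv hrange hv]

variable {B : Type*} [PseudoMetricSpace B] [CompactSpace B] [Nonempty B] {r : ℝ → ℝ}

lemma antitoneOn_entropy (hr : IsEntropyFunction r) (hσ : StrictMonoOn σ (Ioi 0))
    (hrange : Ioc 0 c ⊆ σ '' Ioi 0) :
    AntitoneOn (fun u => r (massiveness B (modulusInv σ u))) (Ioc 0 c) := by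
  intro u hu v hv huv
  have h : ∀ {u}, u ∈ Ioc 0 c → (massiveness B (modulusInv σ u) : ℝ) ∈ Ici (1 : ℝ) := fun hu => by
    simpa using one_le_massiveness (modulusInv_pos hrange hu)
  exact hr.strictMonoOn.monotoneOn (h hv) (h hu) (by
    exact_mod_cast massiveness_anti (modulusInv_pos hrange hu)
      (monotoneOn_modulusInv hσ hrange hu hv huv))

/-- The entropy factor of the chain is bounded by the entropy integral. -/
lemma exp_sum_geomWeight_mul_log_massiveness_le {p : ℝ} (hp₀ : 0 < p) (hp₁ : p < 1) (hc : 0 < c)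
    (hr : IsEntropyFunction r) (hσ : StrictMonoOn σ (Ioi 0)) (hrange : Ioc 0 c ⊆ σ '' Ioi 0)
    (hint : IntegrableOn (fun u => r (massiveness B (modulusInv σ u))) (Ioc 0 c)) (m : ℕ) :
    Real.exp (∑ k ∈ Finset.range (m + 1), geomWeight p m k *
        Real.log (massiveness B (modulusInv σ (c * p ^ k)))) ≤
      entropyInv r (1 / c * ∫ u in (0 : ℝ)..c, r (massiveness B (modulusInv σ u))) := by
  have hmem : ∀ k, c * p ^ k ∈ Ioc 0 c := fun k =>
    ⟨by positivity, mul_le_of_le_one_right hc.le (pow_le_one₀ hp₀.le hp₁.le)⟩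
  have hone : ∀ k, (1 : ℝ) ≤ massiveness B (modulusInv σ (c * p ^ k)) := fun k => by
    exact_mod_cast one_le_massiveness (modulusInv_pos hrange (hmem k))
  have hw := fun k => (geomWeight_pos hp₀ hp₁ m k).le
  refine hr.le_entropyInv (Real.one_le_exp (Finset.sum_nonneg fun k _ =>
    mul_nonneg (hw k) (Real.log_nonneg (hone k)))) ?_
  refine (hr.map_exp_sum_log_le (fun k _ => hw k) (sum_geomWeight p m)
    fun k _ => hone k).trans ?_
  rw [one_div, ← div_eq_inv_mul, le_div_iff₀' hc]
  exact sum_geomWeight_mul_le_integral hp₀ hp₁ hc (antitoneOn_entropy hr hσ hrange) hint m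

end ModulusInv

/-! ### Tail bounds and the theorem. -/

section TailBound

variable {Ω B : Type*} [MeasurableSpace Ω] {μ : Measure Ω} {ζ : ℝ}

/-- All values are compared with one fixed `Y s`, within the diameter of `B`. Boundedness matters
because an unbounded real supremum defaults to `0`. -/
lemma IsModulus.bddAbove_tau [PseudoMetricSpace B] [CompactSpace B] [Nonempty B] (hζ : 0 < ζ)
    {Y : B → Ω → ℝ} {σ : ℝ → ℝ} (hY : IsSubGaussianProcess (powerPhi ζ) μ Y)
    (hσ : IsModulus (powerPhi ζ) μ Y σ) :
    BddAbove (range fun t => tau (powerPhi ζ) μ (Y t)) := by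
  let s : B := Classical.arbitrary B
  let d := Metric.diam (univ : Set B) + 1
  have hd : 0 < d := by
    have := Metric.diam_nonneg (s := (univ : Set B))
    simp only [d]; linarith
  refine ⟨2 * max (σ d) (tau (powerPhi ζ) μ (Y s)), ?_⟩
  rintro _ ⟨t, rfl⟩
  have hts : dist t s ≤ d :=
    (Metric.dist_le_diam_of_mem isCompact_univ.isBounded (mem_univ t) (mem_univ s)).trans
      (le_add_of_nonneg_right zero_le_one)
  have := (((hY t).sub hζ (hY s)).isBound_of_tau_le hζ (hσ.bound d hd t s hts)).add hζ
    ((hY s).isBound_tau hζ)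
  simp only [sub_add_cancel] at this
  exact this.tau_le

/-- Tail bound for the values of a `φ`-sub-Gaussian process on a countable set. -/
theorem measure_exists_lt_abs_le [PseudoMetricSpace B] [CompactSpace B] [Nonempty B]
    (hζ : 1 < ζ) {Y : B → Ω → ℝ} {σ r : ℝ → ℝ} (hY : IsSubGaussianProcess (powerPhi ζ) μ Y)
    (hσ : IsModulus (powerPhi ζ) μ Y σ) (hr : IsEntropyFunction r) {β p δ : ℝ} (hβ : 0 < β)
    (hp₀ : 0 < p) (hp₁ : p < 1) (hδ : 0 < δ) (hrange : Ioc 0 (β * p) ⊆ σ '' Ioi 0)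
    (hint : IntegrableOn (fun u => r (massiveness B (modulusInv σ u))) (Ioc 0 (β * p)))
    {S : Set B} (hS : S.Countable) :
    μ {ω | ∃ t ∈ S, δ < |Y t ω|} ≤ ENNReal.ofReal (2 *
      Real.exp (-((ζ - 1) * (δ * (1 - p)) ^ (ζ / (ζ - 1)) /
        (ζ * ((⨆ u, tau (powerPhi ζ) μ (Y u) ^ ζ) * (1 - p) + p * β ^ ζ) ^ (1 / (ζ - 1))))) *
      entropyInv r (1 / (β * p) *
        ∫ u in (0 : ℝ)..(β * p), r (massiveness B (modulusInv σ u)))) := by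
  have hζ0 : 0 < ζ := one_pos.trans hζ
  have hp : 0 < 1 - p := sub_pos.2 hp₁
  have hc : 0 < β * p := mul_pos hβ hp₀
  set γ := ⨆ u, tau (powerPhi ζ) μ (Y u) ^ ζ with hγ
  set E := entropyInv r (1 / (β * p) *
    ∫ u in (0 : ℝ)..(β * p), r (massiveness B (modulusInv σ u))) with hE
  have hbdd : BddAbove (range fun u => tau (powerPhi ζ) μ (Y u) ^ ζ) := by
    obtain ⟨M, hM⟩ := hσ.bddAbove_tau hζ0 hY
    refine ⟨M ^ ζ, ?_⟩
    rintro _ ⟨t, rfl⟩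
    exact Real.rpow_le_rpow (tau_nonneg _ _) (hM ⟨t, rfl⟩) hζ0.le
  have hγ0 : 0 ≤ γ := Real.iSup_nonneg fun t => Real.rpow_nonneg (tau_nonneg _ _) _
  have hYγ : ∀ t, IsBound (powerPhi ζ) μ (Y t) (γ ^ ζ⁻¹) := fun t =>
    (hY t).isBound_of_tau_le hζ0 <| by
      rw [← Real.rpow_rpow_inv (tau_nonneg (powerPhi ζ) (Y t) (μ := μ)) hζ0.ne']
      exact Real.rpow_le_rpow (Real.rpow_nonneg (tau_nonneg _ _) _) (le_ciSup hbdd t)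
        (inv_nonneg.2 hζ0.le)
  have hA : 0 < γ * (1 - p) + p * β ^ ζ := by
    have := Real.rpow_pos_of_pos hβ ζ
    positivity
  -- Markov's inequality will be applied with exponent `(1 - p) s`, hence the linear term `s * (δ *
  -- (1 - p))`.
  obtain ⟨s, hs, hopt⟩ := exists_optimal_exponent hζ hA (mul_pos hδ hp)
  have hmem : ∀ k, β * p * p ^ k ∈ Ioc 0 (β * p) := fun k =>
    ⟨by positivity, mul_le_of_le_one_right hc.le (pow_le_one₀ hp₀.le hp₁.le)⟩
  choose V hVcard hV using fun k =>
    exists_net_card_eq_massiveness (B := B) (modulusInv_pos hrange (hmem k))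
  choose π hπ hπdist using hV
  -- The net `V k` has `σ`-scale `β p^(k+1)`, which is the bound for the increment of index `k + 1`.
  let b : ℕ → ℝ := fun k => if k = 0 then γ ^ ζ⁻¹ else β * p ^ k
  have hb : ∀ k, b (k + 1) = β * p ^ (k + 1) := fun k => if_neg k.succ_ne_zero
  have hYb : ∀ k t, IsBound (powerPhi ζ) μ (chainIncrement Y π k t) (b k) := by
    rintro (_ | k) t
    · exact hYγ t
    · refine ((hY t).sub hζ0 (hY (π k t))).isBound_of_tau_le hζ0 ?_
      refine (hσ.bound _ (modulusInv_pos hrange (hmem k)) _ _ (hπdist k t)).trans_eq ?_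
      rw [apply_modulusInv hrange (hmem k), hb]
      ring
  have hbs : Summable fun k => b (k + 1) ^ 2 := by
    have h : Summable fun k : ℕ => (β * p) ^ 2 * (p ^ 2) ^ k :=
      (summable_geometric_of_lt_one (by positivity) (pow_lt_one₀ hp₀.le hp₁ two_ne_zero)).mul_left _
    refine h.congr fun k => ?_
    rw [hb]; ring
  have hb0 : b 0 = γ ^ ζ⁻¹ := if_pos rfl
  have hφ : (1 - p) * powerPhi ζ (b 0 * s) + p * powerPhi ζ (β * s) =
      s ^ ζ * (γ * (1 - p) + p * β ^ ζ) / ζ := by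
    have hg : 0 ≤ γ ^ ζ⁻¹ := Real.rpow_nonneg hγ0 _
    rw [hb0, powerPhi_of_nonneg (by positivity), powerPhi_of_nonneg (by positivity),
      Real.mul_rpow hg hs.le, Real.mul_rpow hβ.le hs.le, Real.rpow_inv_rpow hγ0 hζ0.ne']
    ring
  have hchain := measure_exists_lt_abs_le_of_chain (w := geomWeight p) (l := (1 - p) * s)
    (C := 2 * E * Real.exp (s ^ ζ * (γ * (1 - p) + p * β ^ ζ) / ζ))
    (fun k => ⟨_, hπ k (Classical.arbitrary B)⟩) hπ hYb
    (fun k => by rw [hb]; positivity) hbs (geomWeight_pos hp₀ hp₁) (sum_geomWeight p)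
    (mul_pos hp hs) (by
      filter_upwards [eventually_gt_atTop 0] with m hm
      have h1 := exp_sum_geomWeight_mul_log_massiveness_le (B := B) hp₀ hp₁ hc hr
        hσ.strictMonoOn hrange hint m
      simp only [← hVcard, ← hE] at h1
      have h2 := sum_geomWeight_mul_powerPhi_le (s := s) hζ0 hp₀ hp₁ hb hm
      rw [hφ] at h2
      have hE0 : 0 ≤ E := (Real.exp_pos _).le.trans h1
      gcongr) hS δ
  refine hchain.trans_eq ?_
  rw [← hopt, Real.exp_add]
  congr 1
  have e : (1 - p) * s * δ = s * (δ * (1 - p)) := by ring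
  rw [e]
  ring

/-- For a separable process the tail of the supremum is controlled on countable sets. -/
lemma IsSeparableProcess.measure_lt_iSup_le [TopologicalSpace B] {Y : B → Ω → ℝ}
    (hY : IsSeparableProcess μ Y) {δ : ℝ} {c : ENNReal}
    (h : ∀ S : Set B, S.Countable → μ {ω | ∃ t ∈ S, δ < |Y t ω|} ≤ c) :
    μ {ω | ENNReal.ofReal δ < ⨆ t, ENNReal.ofReal |Y t ω|} ≤ c := by
  obtain ⟨S, hS, -, hcl⟩ := hY
  refine le_trans (measure_mono_ae ?_) (h S hS)
  filter_upwards [hcl] with ω hω hlt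
  obtain ⟨t, ht⟩ := lt_iSup_iff.1 hlt
  have ht' : δ < |Y t ω| := lt_of_not_ge fun hle => ht.not_ge (ENNReal.ofReal_le_ofReal hle)
  -- The strict exceedance is an open condition on the graph, so it already occurs at a point of
  -- `S`.
  have hopen : IsOpen {q : B × ℝ | δ < |q.2|} := isOpen_lt continuous_const continuous_snd.abs
  obtain ⟨_, hq, s, hs, rfl⟩ := mem_closure_iff.1 (hω t) _ hopen ht'
  exact ⟨s, hs, hq⟩

end TailBound

end SubPhi

theorem theorem5
    {Ω : Type*} [MeasurableSpace Ω] (μ : Measure Ω) [IsProbabilityMeasure μ]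
    {B : Type*} [MetricSpace B] [CompactSpace B] [Nontrivial B]
    (ζ : ℝ) (hζ₁ : 1 < ζ) (hζ₂ : ζ ≤ 2)
    (X XN : B → Ω → ℝ) (N : ℕ)
    (hX : SubPhi.IsSubGaussianProcess (SubPhi.powerPhi ζ) μ X)
    (hXsep : SubPhi.IsSeparableProcess μ X)
    (hXN : SubPhi.IsSubGaussianProcess (SubPhi.powerPhi ζ) μ XN)
    (hmodel : SubPhi.IsModel μ X N XN)
    (σ σN : ℝ → ℝ)
    (hσ : SubPhi.IsModulus (SubPhi.powerPhi ζ) μ X σ)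
    (hσN : SubPhi.IsModulus (SubPhi.powerPhi ζ) μ (fun t ω => X t ω - XN t ω) σN)
    (r : ℝ → ℝ) (hr : SubPhi.IsEntropyFunction r)
    (β : ℝ) (hβ : β = σ (SubPhi.radius B))
    (p : ℝ) (hp₀ : 0 < p) (hp₁ : p < 1)
    (hrange : Ioc 0 (β * p) ⊆ σN '' Ioi 0)
    (hint : IntegrableOn
      (fun u => r (SubPhi.massiveness B (SubPhi.modulusInv σN u))) (Ioc 0 (β * p)))
    (γζ : ℝ)
    (hγ : γζ = ⨆ u : B, SubPhi.tau (SubPhi.powerPhi ζ) μ (fun ω => X u ω - XN u ω) ^ ζ)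
    (δ : ℝ) (hδ : 0 < δ) (ν : ℝ)
    (hν : 2 * Real.exp (-((ζ - 1) * (δ * (1 - p)) ^ (ζ / (ζ - 1)) /
          (ζ * (γζ * (1 - p) + p * β ^ ζ) ^ (1 / (ζ - 1))))) *
        SubPhi.entropyInv r (1 / (β * p) *
          ∫ u in (0 : ℝ)..(β * p), r (SubPhi.massiveness B (SubPhi.modulusInv σN u))) ≤ ν) :
    SubPhi.Approximates μ X XN ν δ := by
  have hζ : 0 < ζ := one_pos.trans hζ₁
  have hβ₀ : 0 < β := hβ ▸ hσ.pos SubPhi.radius_pos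
  have hsep := hXsep.sub (hmodel.ae_continuous hζ hX hXN hσ hσN)
  refine hsep.measure_lt_iSup_le fun S hS => ?_
  refine (SubPhi.measure_exists_lt_abs_le hζ₁ (fun t => (hX t).sub hζ (hXN t)) hσN hr hβ₀ hp₀ hp₁
    hδ hrange hint hS).trans (ENNReal.ofReal_le_ofReal ?_)
  rwa [← hγ]
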